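/- Let $A(\rho)=A_0+\sum_{i=1}^p\rho_iA_i$ with $A_0,\dots,A_p\in\mathbb{R}^{n\times n}$, let $B\in\mathbb{R}^{n\times m}$, $Q\succeq 0$, $R\succ 0$, $\alpha>0$, and let $\mathcal{P}\subset\mathbb{R}^p$ be a convex and compact polytope. Let $\mathcal{C}=\prod_{i=1}^{mn}[\underline{C}_i,\overline{C}_i]\subset\mathbb{R}^{mn}$, let $g:\mathbb{R}^{mn}\to\mathbb{R}^{2mn}$, $g(k)=(k_1-\underline{C}_1,\dots,k_{mn}-\underline{C}_{mn},\overline{C}_1-k_1,\dots,\overline{C}_{mn}-k_{mn})$, with Jacobian matrix $J_g$, and put $$F=2\operatorname{diag}(g)+J_gJ_g^\top,\qquad M=I-J_g^\top F^{-1}J_g .$$ For $K\in\mathbb{R}^{m\times n}$ and $\rho\in\mathcal{P}$ write $A_K=A(\rho)-BK$, let $P_K$ and $Y_K$ be the solutions of $A_K^\top P_K+P_KA_K+Q+K^\top RK=0$ and $A_KY_K+Y_KA_K^\top+I=0$, and let $$\nabla_{\mathcal{C}}f_K(\rho)=M(\operatorname{vec}K)\,\operatorname{vec}\bigl(2(RK-B^\top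 P_K)Y_K\bigr).$$ Let $\mathcal{K}_{\mathcal{P}}$ be the set of all $K\in\mathbb{R}^{m\times n}$ such that, for every $\rho\in\mathcal{P}$, all eigenvalues of $A(\rho)-BK$ have negative real part. Assume $\mathcal{C}\subseteq\operatorname{vec}(\mathcal{K}_{\mathcal{P}})$. Then there is a convex and compact polytope $\mathcal{V}\subset\mathbb{R}^{mn}$ with $0\in\mathcal{V}$ such that the following holds for every $\rho:[0,\infty)\to\mathcal{P}$ that is continuous except at finitely many times. For every initial gain $K_0$ with $\operatorname{vec}(K_0)\in\operatorname{int}(\mathcal{C})$, the controller equation $$\operatorname{vec}(\dot K)=-\alpha\nabla_{\mathcal{C}}f_K(\rho(t)),\qquad K(0)=K_0,$$ understood in the Carathéodory sense $$\operatorname{vec}(K(t))=\operatorname{vec}(K_0)-\alpha\int_0^t\nabla_{\mathcal{C}}f_{K(\tau)}(\rho(\tau))\,\mathrm{d}\tau ,$$ has a solution on $[0,\infty)$, and every solution on a subinterval of $[0,\infty)$ containing $0$ agrees with it there. This trajectory satisfies $\operatorname{vec}(K(t))\in\operatorname{int}(\mathcal{C})$ for all $t\ge 0$, it is continuous on $[0,\infty)$,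 and at every time $t\ge 0$ at which $\rho$ is continuous it is differentiable (from the right if $t=0$) with $\operatorname{vec}(\dot K(t))\in\mathcal{V}$. -/

import Mathlib

open Set MeasureTheory
open scoped Matrix

noncomputable section

namespace ProjectedLQR

/-- A convex compact polytope: the convex hull of finitely many points. -/
def IsPolytope {ι : Type*} (S : Set (ι → ℝ)) : Prop :=
  ∃ F : Set (ι → ℝ), F.Finite ∧ S = convexHull ℝ F

/-- The times in `[0, ∞)` at which the trajectory `x` is discontinuous. -/
def discontinuities {E : Type*} [TopologicalSpace E] (x : ℝ → E) : Set ℝ :=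
  {t | 0 ≤ t ∧ ¬ ContinuousWithinAt x (Ici 0) t}

/-- The piecewise continuous trajectories `[0, ∞) → S` with finitely many discontinuities.
Trajectories are functions on `ℝ` of which only the restriction to `[0, ∞)` matters. One-sided
limits at the discontinuities are not required to exist. -/
def piecewiseContinuousTrajectories {E : Type*} [TopologicalSpace E] (S : Set E) :
    Set (ℝ → E) :=
  {x | (∀ t, 0 ≤ t → x t ∈ S) ∧ (discontinuities x).Finite}

/-- The continuous trajectories `[0, ∞) → S` that are differentiable with derivative in `V` at all
times outside `D` (one-sided derivative at time `0`). -/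
def rateBoundedTrajectories {ι : Type*} [Fintype ι] (S V : Set (ι → ℝ)) (D : Set ℝ) :
    Set (ℝ → ι → ℝ) :=
  {x | (∀ t, 0 ≤ t → x t ∈ S) ∧ ContinuousOn x (Ici 0) ∧
    ∀ t, 0 ≤ t → t ∉ D → ∃ v ∈ V, HasDerivWithinAt x v (Ici 0) t}

/-- The affine family `A(ρ) = A₀ + ∑ i, ρ i • A₁ i`. -/
def affineFamily {n p : ℕ} (A₀ : Matrix (Fin n) (Fin n) ℝ)
    (A₁ : Fin p → Matrix (Fin n) (Fin n) ℝ) (ρ : Fin p → ℝ) : Matrix (Fin n) (Fin n) ℝ :=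
  A₀ + ∑ i, ρ i • A₁ i

/-- All complex eigenvalues of the real matrix `M` have negative real part. -/
def IsHurwitz {n : ℕ} (M : Matrix (Fin n) (Fin n) ℝ) : Prop :=
  ∀ μ ∈ spectrum ℂ (M.map (algebraMap ℝ ℂ)), μ.re < 0

/-- The gains `K` for which `A - B K` is Hurwitz. -/
def stableGains {n m : ℕ} (A : Matrix (Fin n) (Fin n) ℝ) (B : Matrix (Fin n) (Fin m) ℝ) :
    Set (Matrix (Fin m) (Fin n) ℝ) :=
  {K | IsHurwitz (A - B * K)}

/-- The gains that stabilize every frozen system `(A(ρ), B)`, `ρ ∈ P`. -/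
def commonStableGains {n m p : ℕ} (A : (Fin p → ℝ) → Matrix (Fin n) (Fin n) ℝ)
    (B : Matrix (Fin n) (Fin m) ℝ) (P : Set (Fin p → ℝ)) : Set (Matrix (Fin m) (Fin n) ℝ) :=
  ⋂ ρ ∈ P, stableGains (A ρ) B

/-- The solution `X` of the Lyapunov equation `Mᵀ X + X M + W = 0` (it exists and is unique when
`M` is Hurwitz; otherwise some solution, or an arbitrary matrix if there is none). -/
def lyapunovSolution {n : ℕ} (M W : Matrix (Fin n) (Fin n) ℝ) : Matrix (Fin n) (Fin n) ℝ :=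
  Classical.epsilon fun X => Mᵀ * X + X * M + W = 0

/-- The cost matrix `P_K`: `A_Kᵀ P + P A_K + Q + Kᵀ R K = 0` with `A_K = A - B K`. -/
def costMatrix {n m : ℕ} (A : Matrix (Fin n) (Fin n) ℝ) (B : Matrix (Fin n) (Fin m) ℝ)
    (Q : Matrix (Fin n) (Fin n) ℝ) (R : Matrix (Fin m) (Fin m) ℝ)
    (K : Matrix (Fin m) (Fin n) ℝ) : Matrix (Fin n) (Fin n) ℝ :=
  lyapunovSolution (A - B * K) (Q + Kᵀ * R * K)

/-- The matrix `Y_K`: `A_K Y + Y A_Kᵀ + I = 0` with `A_K = A - B K`. -/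
def gramMatrix {n m : ℕ} (A : Matrix (Fin n) (Fin n) ℝ) (B : Matrix (Fin n) (Fin m) ℝ)
    (K : Matrix (Fin m) (Fin n) ℝ) : Matrix (Fin n) (Fin n) ℝ :=
  lyapunovSolution (A - B * K)ᵀ 1

/-- The policy gradient `2 (R K - Bᵀ P_K) Y_K` of the LQR cost `K ↦ tr P_K`. -/
def policyGradient {n m : ℕ} (A : Matrix (Fin n) (Fin n) ℝ) (B : Matrix (Fin n) (Fin m) ℝ)
    (Q : Matrix (Fin n) (Fin n) ℝ) (R : Matrix (Fin m) (Fin m) ℝ)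
    (K : Matrix (Fin m) (Fin n) ℝ) : Matrix (Fin m) (Fin n) ℝ :=
  (2 : ℝ) • ((R * K - Bᵀ * costMatrix A B Q R K) * gramMatrix A B K)

/-- The Jacobian matrix of `g` at `x`. -/
def jacobian {ι κ : Type*} [Fintype ι] [Fintype κ] [DecidableEq ι]
    (g : (ι → ℝ) → κ → ℝ) (x : ι → ℝ) : Matrix κ ι ℝ :=
  LinearMap.toMatrix' (fderiv ℝ g x : (ι → ℝ) →ₗ[ℝ] κ → ℝ)

/-- `M(x) = I - Jᵀ F⁻¹ J` with `J` the Jacobian matrix of `g` at `x` and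
`F = 2 diag(g(x)) + J Jᵀ`. -/
def projectionMatrix {ι κ : Type*} [Fintype ι] [Fintype κ] [DecidableEq ι] [DecidableEq κ]
    (g : (ι → ℝ) → κ → ℝ) (x : ι → ℝ) : Matrix ι ι ℝ :=
  1 - (jacobian g x)ᵀ *
    ((2 : ℝ) • Matrix.diagonal (g x) + jacobian g x * (jacobian g x)ᵀ)⁻¹ * jacobian g x

/-- The hyperrectangle `∏ i, [l i, u i]`. -/
def hyperrectangle {ι : Type*} (l u : ι → ℝ) : Set (ι → ℝ) :=
  Set.pi univ fun i => Icc (l i) (u i)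

/-- The constraint functions `x i - l i` and `u i - x i` of the hyperrectangle. -/
def boxConstraint {ι : Type*} (l u : ι → ℝ) (x : ι → ℝ) : ι ⊕ ι → ℝ :=
  Sum.elim (fun i => x i - l i) (fun i => u i - x i)

/-- The projected gradient `M(K) vec(2 (R K - Bᵀ P_K) Y_K)` of the LQR cost of `(A, B)` onto the
hyperrectangle with bounds `l`, `u`. -/
def projectedGradient {n m : ℕ} (A : Matrix (Fin n) (Fin n) ℝ) (B : Matrix (Fin n) (Fin m) ℝ)
    (Q : Matrix (Fin n) (Fin n) ℝ) (R : Matrix (Fin m) (Fin m) ℝ) (l u : Fin n × Fin m → ℝ)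
    (K : Matrix (Fin m) (Fin n) ℝ) : Fin n × Fin m → ℝ :=
  projectionMatrix (boxConstraint l u) K.vec *ᵥ (policyGradient A B Q R K).vec

/-- `K` is, on the time set `J`, a trajectory of the dynamic controller
`vec(K') = -α ∇_C f_K(ρ(t))`, `vec(K(0)) ∈ int C`, in the sense of Carathéodory, that is, it solves
the integrated equation. -/
structure IsControllerTrajectory {n m p : ℕ} (A : (Fin p → ℝ) → Matrix (Fin n) (Fin n) ℝ)
    (B : Matrix (Fin n) (Fin m) ℝ) (Q : Matrix (Fin n) (Fin n) ℝ) (R : Matrix (Fin m) (Fin m) ℝ)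
    (l u : Fin n × Fin m → ℝ) (α : ℝ) (ρ : ℝ → Fin p → ℝ) (J : Set ℝ)
    (K : ℝ → Matrix (Fin m) (Fin n) ℝ) : Prop where
  initial : (K 0).vec ∈ interior (hyperrectangle l u)
  integrable : ∀ t ∈ J, IntervalIntegrable
    (fun τ => projectedGradient (A (ρ τ)) B Q R l u (K τ)) volume 0 t
  equation : ∀ t ∈ J, (K t).vec =
    (K 0).vec - α • ∫ τ in (0 : ℝ)..t, projectedGradient (A (ρ τ)) B Q R l u (K τ)

end ProjectedLQR

end

/-! For a box, the projection matrix is diagonal: with `a = x i - l i` and `b = u i - x i`, its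
entries are `2ab / (2ab + a + b)` (`projectionMatrix_boxConstraint`). Each entry is at most `1`,
`2a` and `2b`, so every component of the controller field vanishes at least linearly at the two
facets bounding that coordinate. By Grönwall, the distance to a facet can then decay at most
exponentially, and a solution starting in the interior never reaches the boundary
(`pos_of_abs_le_mul_abs`).

The remaining ingredient is regularity. Lyapunov operators of Hurwitz matrices are invertible, and
inversion is smooth, so the policy gradient is `C¹` in parameter and gain on the compact convex set
`P ×ˢ hyperrectangle l u` (`contDiffOn_vec_policyGradient`). Hence the field is bounded and
Lipschitz there, with constants independent of `ρ` (`exists_controllerField_bounds`).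

Outside the box nothing is known about the field. Existence is therefore proved for the field
composed with the nearest-point map of the box, by a contraction argument
(`exists_integral_solution`); invariance shows afterwards that the composition changed nothing along
the solution (`exists_solution_in_interior`). Uniqueness needs only one of the two solutions to be
known to stay in the interior (`eqOn_of_integral_solution`), so every trajectory equals the
constructed one and inherits its properties. -/

namespace ProjectedLQR

/-! ### Grönwall estimates and Carathéodory solutions. -/

section Caratheodory

open Filter Topology
open scoped NNReal BoundedContinuousFunction

/-- Grönwall's inequality in integral form, with vanishing initial value. -/
theorem eq_zero_of_le_mul_integral {φ : ℝ → ℝ} {a b C : ℝ} (hφ : ContinuousOn φ (Icc a b))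
    (hnonneg : ∀ t ∈ Icc a b, 0 ≤ φ t) (hle : ∀ t ∈ Icc a b, φ t ≤ C * ∫ τ in a..t, φ τ) :
    ∀ t ∈ Icc a b, φ t = 0 := by
  intro t ht
  have hab : a ≤ b := ht.1.trans ht.2
  -- The constant extension is continuous on all of `ℝ`, so its primitive has a two-sided derivative
  -- even at the endpoints.
  set ψ : ℝ → ℝ := IccExtend hab ((Icc a b).domRestrict φ) with hψ
  have hψc : Continuous ψ := (continuousOn_iff_continuous_domRestrict.1 hφ).Icc_extend'
  have hψφ : ∀ s ∈ Icc a b, ψ s = φ s := fun s hs => by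
    simp [hψ, IccExtend_of_mem hab _ hs, domRestrict_apply]
  have hint : ∀ s ∈ Icc a b, ∫ τ in a..s, φ τ = ∫ τ in a..s, ψ τ := fun s hs =>
    intervalIntegral.integral_congr fun τ hτ => by
      rw [uIcc_of_le hs.1] at hτ
      exact (hψφ τ ⟨hτ.1, hτ.2.trans hs.2⟩).symm
  have hderiv : ∀ s, HasDerivAt (fun r => ∫ τ in a..r, ψ τ) (ψ s) s := fun s =>
    hψc.integral_hasStrictDerivAt a s |>.hasDerivAt
  have hzero : ∀ s ∈ Icc a b, ∫ τ in a..s, ψ τ = 0 := by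
    refine eq_zero_of_abs_deriv_le_mul_abs_self_of_eq_zero_right (f' := ψ) (K := |C|)
      (fun s _ => (hderiv s).continuousAt.continuousWithinAt)
      (fun s _ => (hderiv s).hasDerivWithinAt) (by simp) ?_
    intro s hs
    have hs' := Ico_subset_Icc_self hs
    rw [hψφ s hs', Real.norm_of_nonneg (hnonneg s hs'), Real.norm_eq_abs, ← abs_mul]
    exact (hle s hs').trans (by rw [hint s hs']; exact le_abs_self _)
  refine le_antisymm ?_ (hnonneg t ht)
  simpa [hint t ht, hzero t ht] using hle t ht

/-- A function whose rate of change is dominated by its absolute value keeps its positive sign. -/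
theorem pos_of_abs_le_mul_abs {φ h : ℝ → ℝ} {C T : ℝ} (hT : 0 ≤ T)
    (hφ : ContinuousOn φ (Icc 0 T)) (hint : IntervalIntegrable h volume 0 T)
    (heq : ∀ t ∈ Icc 0 T, φ t = φ 0 + ∫ τ in (0 : ℝ)..t, h τ)
    (hle : ∀ t ∈ Icc 0 T, |h t| ≤ C * |φ t|) (h0 : 0 < φ 0) : 0 < φ T := by
  by_contra! hneg
  obtain ⟨s, hs, hs0⟩ : (0 : ℝ) ∈ φ '' Icc 0 T :=
    intermediate_value_Icc' hT hφ ⟨hneg, h0.le⟩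
  have hsub : ∀ r ∈ Icc 0 s, s - r ∈ Icc 0 T := fun r hr =>
    ⟨by linarith [hr.2], by linarith [hr.1, hs.2]⟩
  have hii : ∀ r ∈ Icc 0 T, IntervalIntegrable h volume 0 r := fun r hr =>
    hint.mono_set (by rw [uIcc_of_le hr.1, uIcc_of_le hT]; exact Icc_subset_Icc_right hr.2)
  -- Grönwall is run backwards in time from the zero `s` of `φ`; it would force `φ 0 = 0`.
  have key := eq_zero_of_le_mul_integral (φ := fun r => |φ (s - r)|) (a := 0) (b := s) (C := C)
    (continuous_abs.comp_continuousOn (hφ.comp (by fun_prop) hsub))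
    (fun _ _ => abs_nonneg _) ?_ s ⟨hs.1, le_rfl⟩
  · simp only [sub_self, abs_eq_zero] at key
    exact h0.ne' key
  intro r hr
  have hr' := hsub r hr
  have h1 : φ (s - r) = -∫ τ in (s - r)..s, h τ := by
    have := intervalIntegral.integral_interval_sub_left (hii s hs) (hii _ hr')
    have e1 := heq s hs
    have e2 := heq _ hr'
    linarith
  have h2 : ∫ τ in (0 : ℝ)..r, |φ (s - τ)| = ∫ τ in (s - r)..s, |φ τ| := by
    rw [intervalIntegral.integral_comp_sub_left (fun τ => |φ τ|) s, sub_zero]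
  have hsr : s - r ≤ s := by linarith [hr.1]
  have hIcc : Icc (s - r) s ⊆ Icc 0 T := Icc_subset_Icc hr'.1 hs.2
  rw [h1, h2, abs_neg, ← intervalIntegral.integral_const_mul, ← Real.norm_eq_abs]
  refine intervalIntegral.norm_integral_le_of_norm_le hsr
    (Eventually.of_forall fun τ hτ => hle τ (hIcc (Ioc_subset_Icc_self hτ))) ?_
  apply ContinuousOn.intervalIntegrable
  rw [uIcc_of_le hsr]
  exact continuousOn_const.mul (continuous_abs.comp_continuousOn (hφ.mono hIcc))

theorem intervalIntegrable_of_norm_le {E : Type*} [NormedAddCommGroup E]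
    {f : ℝ → E} {c : ℝ} (hf : AEStronglyMeasurable f volume) (hc : ∀ t, ‖f t‖ ≤ c) (a b : ℝ) :
    IntervalIntegrable f volume a b := by
  rw [intervalIntegrable_iff]
  exact Measure.integrableOn_of_bounded (M := c) measure_Ioc_lt_top.ne hf
    (Eventually.of_forall hc)

variable {E : Type*} [NormedAddCommGroup E] [NormedSpace ℝ E]

/-- Global existence of Carathéodory solutions for bounded, uniformly Lipschitz fields. -/
theorem exists_integral_solution [CompleteSpace E] {h : ℝ → E → E} {L : ℝ≥0} {c : ℝ}
    (hlip : ∀ τ, LipschitzWith L (h τ)) (hbdd : ∀ τ x, ‖h τ x‖ ≤ c)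
    (hmeas : ∀ x : ℝ → E, Continuous x → AEStronglyMeasurable (fun τ => h τ (x τ)) volume)
    (x₀ : E) :
    ∃ x : ℝ → E, Continuous x ∧ ∀ t, 0 ≤ t → x t = x₀ + ∫ τ in (0 : ℝ)..t, h τ (x τ) := by
  have hc : 0 ≤ c := (norm_nonneg _).trans (hbdd 0 0)
  -- The term `2 * L` makes the contraction factor `L / lam` at most `1 / 2`; the term `1` gives `s
  -- ≤ exp (lam * s)`, which keeps the weighted integrals bounded by `c`.
  set lam : ℝ := 2 * L + 1 with hlam
  have hlam1 : 1 ≤ lam := by simp [hlam]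
  -- The unknown is the exponentially weighted deviation from `x₀`, so one contraction covers all of
  -- `[0, ∞)`.
  let X : (ℝ →ᵇ E) → ℝ → E := fun z τ => x₀ + Real.exp (lam * τ) • z τ
  have hX : ∀ z, Continuous (X z) := fun z =>
    continuous_const.add ((by fun_prop : Continuous fun τ => Real.exp (lam * τ)).smul z.continuous)
  have hii : ∀ z a b, IntervalIntegrable (fun τ => h τ (X z τ)) volume a b := fun z a b =>
    intervalIntegrable_of_norm_le (hmeas _ (hX z)) (fun τ => hbdd τ _) a b
  let S : (ℝ →ᵇ E) → ℝ → E := fun z t =>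
    Real.exp (-(lam * max t 0)) • ∫ τ in (0 : ℝ)..max t 0, h τ (X z τ)
  have hS : ∀ z, Continuous (S z) := fun z =>
    (by fun_prop : Continuous fun t => Real.exp (-(lam * max t 0))).smul
      ((intervalIntegral.continuous_primitive (hii z) 0).comp (by fun_prop))
  have hSb : ∀ z t, ‖S z t‖ ≤ c := by
    intro z t
    have hs : 0 ≤ max t 0 := le_max_right _ _
    generalize hst : max t 0 = s at hs
    have h1 : ‖∫ τ in (0 : ℝ)..s, h τ (X z τ)‖ ≤ c * s := by
      simpa [abs_of_nonneg hs] using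
        intervalIntegral.norm_integral_le_of_norm_le_const (a := 0) (b := s) (C := c)
          (f := fun τ => h τ (X z τ)) fun τ _ => hbdd τ _
    have h2 : s ≤ Real.exp (lam * s) := by
      have := Real.add_one_le_exp (lam * s)
      nlinarith
    simp only [S, hst, norm_smul, Real.norm_eq_abs, Real.abs_exp]
    rw [Real.exp_neg]
    rw [inv_mul_le_iff₀ (Real.exp_pos _)]
    nlinarith
  let Φ : (ℝ →ᵇ E) → (ℝ →ᵇ E) := fun z =>
    BoundedContinuousFunction.ofNormedAddCommGroup (S z) (hS z) c (hSb z)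
  have hΦ : ContractingWith (1 / 2) Φ := by
    refine ⟨by norm_num, LipschitzWith.of_dist_le_mul fun z w => ?_⟩
    refine (BoundedContinuousFunction.dist_le (by positivity)).2 fun t => ?_
    change dist (S z t) (S w t) ≤ _
    have hs : 0 ≤ max t 0 := le_max_right _ _
    generalize hst : max t 0 = s at hs
    have h1 : ∀ τ, ‖h τ (X z τ) - h τ (X w τ)‖ ≤ L * dist z w * Real.exp (lam * τ) := by
      intro τ
      rw [← dist_eq_norm]
      refine ((hlip τ).dist_le_mul _ _).trans ?_
      simp only [X, dist_add_left, dist_smul₀, Real.norm_eq_abs, Real.abs_exp]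
      have := BoundedContinuousFunction.dist_coe_le_dist (f := z) (g := w) τ
      rw [mul_assoc, mul_comm (dist z w)]
      gcongr
    have h2 : ‖(∫ τ in (0 : ℝ)..s, h τ (X z τ)) - ∫ τ in (0 : ℝ)..s, h τ (X w τ)‖ ≤
        L * dist z w * (lam⁻¹ * (Real.exp (lam * s) - 1)) := by
      rw [← intervalIntegral.integral_sub (hii z _ _) (hii w _ _)]
      refine (intervalIntegral.norm_integral_le_of_norm_le hs
        (Eventually.of_forall fun τ _ => h1 τ)
        (Continuous.intervalIntegrable (by fun_prop) _ _)).trans_eq ?_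
      rw [intervalIntegral.integral_const_mul,
        intervalIntegral.integral_comp_mul_left (fun τ => Real.exp τ) (by positivity)]
      simp
    simp only [S, hst, dist_smul₀, Real.norm_eq_abs, Real.abs_exp]
    rw [Real.exp_neg, dist_eq_norm, inv_mul_le_iff₀ (Real.exp_pos _)]
    refine h2.trans ?_
    have h3 : (L : ℝ) * lam⁻¹ ≤ 1 / 2 := by
      rw [← div_eq_mul_inv, div_le_iff₀ (by positivity)]
      linarith
    have h4 : (0 : ℝ) ≤ L * lam⁻¹ := by positivity
    calc L * dist z w * (lam⁻¹ * (Real.exp (lam * s) - 1))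
        = (L * lam⁻¹) * (dist z w * (Real.exp (lam * s) - 1)) := by ring
      _ ≤ (L * lam⁻¹) * (dist z w * Real.exp (lam * s)) := by gcongr; linarith
      _ ≤ 1 / 2 * (dist z w * Real.exp (lam * s)) := by gcongr
      _ = _ := by push_cast; ring
  refine ⟨X (hΦ.fixedPoint Φ), hX _, fun t ht => ?_⟩
  have hfix : S (hΦ.fixedPoint Φ) t = hΦ.fixedPoint Φ t :=
    congrArg (fun z : ℝ →ᵇ E => z t) (hΦ.fixedPoint_isFixedPt : Φ _ = _)
  change x₀ + Real.exp (lam * t) • hΦ.fixedPoint Φ t = _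
  rw [← hfix]
  simp only [S, max_eq_left ht, smul_smul, ← Real.exp_add, add_neg_cancel, Real.exp_zero, one_smul]

/-- An integral solution that stays in the interior of a set on which the field is uniformly
Lipschitz is unique. -/
theorem eqOn_of_integral_solution {h : ℝ → E → E} {U : Set E} {L : ℝ≥0} {T : ℝ} {x y : ℝ → E}
    (hlip : ∀ τ ∈ Icc 0 T, LipschitzOnWith L (h τ) U)
    (hxU : ∀ t ∈ Icc 0 T, x t ∈ interior U)
    (hxi : IntervalIntegrable (fun τ => h τ (x τ)) volume 0 T)
    (hyi : IntervalIntegrable (fun τ => h τ (y τ)) volume 0 T)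
    (hx : ∀ t ∈ Icc 0 T, x t = x 0 + ∫ τ in (0 : ℝ)..t, h τ (x τ))
    (hy : ∀ t ∈ Icc 0 T, y t = y 0 + ∫ τ in (0 : ℝ)..t, h τ (y τ))
    (h0 : y 0 = x 0) : EqOn y x (Icc 0 T) := by
  have hcont : ∀ z : ℝ → E, IntervalIntegrable (fun τ => h τ (z τ)) volume 0 T →
      (∀ t ∈ Icc 0 T, z t = z 0 + ∫ τ in (0 : ℝ)..t, h τ (z τ)) → ContinuousOn z (Icc 0 T) := by
    intro z hzi hz t ht
    have := intervalIntegral.continuousOn_primitive_interval' hzi (a := 0) left_mem_uIcc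
    rw [uIcc_of_le (ht.1.trans ht.2)] at this
    exact (continuousOn_const.add this).congr hz t ht
  have hxc := hcont x hxi hx
  have hyc := hcont y hyi hy
  have hclosed : IsClosed ({t | y t = x t} ∩ Icc 0 T) := by
    have : {t | y t = x t} ∩ Icc 0 T = Icc 0 T ∩ (fun t => y t - x t) ⁻¹' {0} := by
      ext t; simp [sub_eq_zero, and_comm]
    rw [this]
    exact (hyc.sub hxc).preimage_isClosed_of_isClosed isClosed_Icc isClosed_singleton
  refine hclosed.Icc_subset_of_forall_mem_nhdsWithin h0 ?_
  rintro s ⟨hs : y s = x s, hsT⟩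
  have hs' := Ico_subset_Icc_self hsT
  -- At a time of agreement `y` sits at an interior point of `U`, so it stays in `U` for a short
  -- while; there the Lipschitz bound and Grönwall extend the agreement to the right.
  have hnear : ∀ᶠ r in 𝓝[Icc 0 T] s, y r ∈ U :=
    (hyc s hs').eventually_mem (by rw [hs]; exact mem_interior_iff_mem_nhds.1 (hxU s hs'))
  obtain ⟨δ, hδ, hδU⟩ := Metric.mem_nhdsWithin_iff.1 hnear
  obtain ⟨b, hsb, hb⟩ : ∃ b, s < b ∧ b < min (s + δ) T :=
    exists_between (lt_min (by linarith) hsT.2)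
  rw [lt_min_iff] at hb
  have hsub : Icc s b ⊆ Icc 0 T := Icc_subset_Icc hsT.1 hb.2.le
  have hyU : ∀ r ∈ Icc s b, y r ∈ U := fun r hr => hδU
    ⟨by rw [Metric.mem_ball, Real.dist_eq, abs_of_nonneg (by linarith [hr.1])]; linarith [hr.2],
      hsub hr⟩
  have h0T : (0 : ℝ) ∈ Icc 0 T := ⟨le_rfl, hsT.1.trans hsT.2.le⟩
  have hsubi : ∀ z : ℝ → E, IntervalIntegrable (fun τ => h τ (z τ)) volume 0 T →
      ∀ t ∈ Icc 0 T, ∀ t' ∈ Icc 0 T, IntervalIntegrable (fun τ => h τ (z τ)) volume t t' := by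
    intro z hz t ht t' ht'
    refine hz.mono_set ?_
    rw [← uIcc_of_le h0T.2] at ht ht'
    exact uIcc_subset_uIcc ht ht'
  have hdiff : ∀ r ∈ Icc s b, y r - x r = ∫ τ in s..r, (h τ (y τ) - h τ (x τ)) := by
    intro r hr
    have e1 := intervalIntegral.integral_interval_sub_left
      (hsubi x hxi 0 h0T r (hsub hr)) (hsubi x hxi 0 h0T s hs')
    have e2 := intervalIntegral.integral_interval_sub_left
      (hsubi y hyi 0 h0T r (hsub hr)) (hsubi y hyi 0 h0T s hs')
    rw [intervalIntegral.integral_sub (hsubi y hyi s hs' r (hsub hr))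
      (hsubi x hxi s hs' r (hsub hr)), ← e1, ← e2]
    have f1 := hx s hs'
    have f2 := hy s hs'
    rw [hs] at f2
    have f3 : ∫ τ in (0 : ℝ)..s, h τ (y τ) = ∫ τ in (0 : ℝ)..s, h τ (x τ) := by
      have := f2.symm.trans f1
      rw [h0] at this
      exact add_left_cancel this
    rw [hx r (hsub hr), hy r (hsub hr), h0, f3]
    abel
  have key := eq_zero_of_le_mul_integral (φ := fun r => ‖y r - x r‖) (a := s) (b := b)
    (C := L) ((hyc.sub hxc).norm.mono hsub) (fun _ _ => norm_nonneg _) ?_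
  · refine mem_of_superset (Icc_mem_nhdsGT hsb) fun r hr => ?_
    exact sub_eq_zero.1 (norm_eq_zero.1 (key r hr))
  intro r hr
  have hrb : Icc s r ⊆ Icc s b := Icc_subset_Icc_right hr.2
  rw [hdiff r hr, ← intervalIntegral.integral_const_mul]
  refine intervalIntegral.norm_integral_le_of_norm_le hr.1
    (Eventually.of_forall fun τ hτ => ?_) ?_
  · have hτ' := hrb (Ioc_subset_Icc_self hτ)
    rw [← dist_eq_norm, ← dist_eq_norm]
    exact (hlip τ (hsub hτ')).dist_le_mul _ (hyU τ hτ') _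
      (interior_subset (hxU τ (hsub hτ')))
  · apply ContinuousOn.intervalIntegrable
    rw [uIcc_of_le hr.1]
    exact continuousOn_const.mul ((hyc.sub hxc).norm.mono (hrb.trans hsub))

end Caratheodory

/-! ### Lyapunov equations and smoothness of the policy gradient. -/

section Lyapunov

/-- The Sylvester equation `N X = X M` has only the trivial solution if the spectra of `N` and `M`
are disjoint. -/
theorem eq_zero_of_mul_eq_mul_of_disjoint_spectrum {ι : Type*} [Fintype ι] [DecidableEq ι]
    {N M X : Matrix ι ι ℂ} (hdisj : Disjoint (spectrum ℂ N) (spectrum ℂ M))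
    (hX : N * X = X * M) : X = 0 := by
  cases isEmpty_or_nonempty ι
  · exact Subsingleton.elim _ _
  have hpoly : ∀ q : Polynomial ℂ, Polynomial.aeval N q * X = X * Polynomial.aeval M q := by
    intro q
    induction q using Polynomial.induction_on' with
    | add a b ha hb => simp [add_mul, mul_add, ha, hb]
    | monomial k a =>
      have hk : N ^ k * X = X * M ^ k := (SemiconjBy.pow_right (a := X) hX.symm k).eq.symm
      rw [Polynomial.aeval_monomial, Polynomial.aeval_monomial, mul_assoc, hk,
        ← mul_assoc, ← mul_assoc, Algebra.commutes]
  -- No eigenvalue of `M` is a root of the characteristic polynomial of `N`, so that polynomial is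
  -- invertible at `M`, while it vanishes at `N` by Cayley–Hamilton.
  have hunit : IsUnit (Polynomial.aeval M N.charpoly) := by
    rw [← spectrum.zero_notMem_iff ℂ, spectrum.map_polynomial_aeval_of_degree_pos]
    · rintro ⟨k, hk, hk0⟩
      exact hdisj.le_bot ⟨Matrix.mem_spectrum_iff_isRoot_charpoly.2 hk0, hk⟩
    · rw [Matrix.charpoly_degree_eq_dim]
      exact_mod_cast Fintype.card_pos
  have := hpoly N.charpoly
  rw [Matrix.aeval_self_charpoly, zero_mul] at this
  exact (hunit.mul_left_eq_zero).1 this.symm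

variable {n : ℕ}

theorem IsHurwitz.transpose {M : Matrix (Fin n) (Fin n) ℝ} (hM : IsHurwitz M) :
    IsHurwitz Mᵀ := by
  intro μ hμ
  refine hM μ ?_
  rw [Matrix.mem_spectrum_iff_isRoot_charpoly] at hμ ⊢
  rwa [Matrix.transpose_map, Matrix.charpoly_transpose] at hμ

/-- The equation is the Sylvester equation for `Mᵀ` and `-M`, whose complex spectra lie in opposite
open half-planes. -/
theorem IsHurwitz.eq_zero_of_lyapunov {M X : Matrix (Fin n) (Fin n) ℝ} (hM : IsHurwitz M)
    (hX : Mᵀ * X + X * M = 0) : X = 0 := by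
  have hmap : X.map (algebraMap ℝ ℂ) = 0 := by
    refine eq_zero_of_mul_eq_mul_of_disjoint_spectrum (N := Mᵀ.map (algebraMap ℝ ℂ))
      (M := -M.map (algebraMap ℝ ℂ)) ?_ ?_
    · rw [Set.disjoint_left]
      intro μ hμ hμ'
      rw [← spectrum.neg_eq, Set.mem_neg] at hμ'
      have h1 := hM.transpose μ hμ
      have h2 := hM (-μ) hμ'
      rw [Complex.neg_re] at h2
      linarith
    · rw [mul_neg, ← Matrix.map_mul, ← Matrix.map_mul, eq_neg_iff_add_eq_zero,
        ← Matrix.map_add _ (map_add _), hX]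
      simp
  ext i j
  have := congrFun (congrFun hmap i) j
  simpa using this

attribute [local instance] Matrix.normedAddCommGroup Matrix.normedSpace

/-- The Lyapunov operator `X ↦ Mᵀ X + X M`, on the underlying functions of matrices, so that the
space of continuous operators carries its usual norm. -/
noncomputable def lyapunovOperator (M : Matrix (Fin n) (Fin n) ℝ) :
    (Fin n → Fin n → ℝ) →L[ℝ] (Fin n → Fin n → ℝ) :=
  LinearMap.toContinuousLinearMap (E := Fin n → Fin n → ℝ) (F' := Fin n → Fin n → ℝ)
    (LinearMap.mulLeft ℝ Mᵀ + LinearMap.mulRight ℝ M)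

theorem lyapunovOperator_apply (M X : Matrix (Fin n) (Fin n) ℝ) :
    lyapunovOperator M X = Mᵀ * X + X * M := rfl

theorem contDiff_lyapunovOperator :
    ContDiff ℝ 1 (lyapunovOperator (n := n)) := by
  let Λ : (Fin n → Fin n → ℝ) →ₗ[ℝ] (Fin n → Fin n → ℝ) →L[ℝ] (Fin n → Fin n → ℝ) :=
    { toFun := lyapunovOperator
      map_add' := fun (M N : Matrix (Fin n) (Fin n) ℝ) => by
        refine ContinuousLinearMap.ext fun (X : Matrix (Fin n) (Fin n) ℝ) => ?_
        change (M + N : Matrix (Fin n) (Fin n) ℝ)ᵀ * X + X * (M + N : Matrix (Fin n) (Fin n) ℝ) =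
          (Mᵀ * X + X * M : Matrix (Fin n) (Fin n) ℝ) +
            (Nᵀ * X + X * N : Matrix (Fin n) (Fin n) ℝ)
        rw [Matrix.transpose_add, Matrix.add_mul, Matrix.mul_add]
        abel
      map_smul' := fun c (M : Matrix (Fin n) (Fin n) ℝ) => by
        refine ContinuousLinearMap.ext fun (X : Matrix (Fin n) (Fin n) ℝ) => ?_
        change (c • M : Matrix (Fin n) (Fin n) ℝ)ᵀ * X + X * (c • M : Matrix (Fin n) (Fin n) ℝ) =
          c • (Mᵀ * X + X * M : Matrix (Fin n) (Fin n) ℝ)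
        rw [Matrix.transpose_smul, Matrix.smul_mul, Matrix.mul_smul, smul_add] }
  exact (LinearMap.toContinuousLinearMap Λ).contDiff

theorem IsHurwitz.exists_equiv {M : Matrix (Fin n) (Fin n) ℝ} (hM : IsHurwitz M) :
    ∃ e : (Fin n → Fin n → ℝ) ≃L[ℝ] (Fin n → Fin n → ℝ),
      (e : (Fin n → Fin n → ℝ) →L[ℝ] (Fin n → Fin n → ℝ)) = lyapunovOperator M := by
  have hinj : Function.Injective (lyapunovOperator M).toLinearMap :=
    (injective_iff_map_eq_zero _).2 fun X hX => hM.eq_zero_of_lyapunov hX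
  exact ⟨(LinearEquiv.ofInjectiveEndo _ hinj).toContinuousLinearEquiv,
    ContinuousLinearMap.ext fun _ => rfl⟩

/-- Uniqueness removes the arbitrariness of `Classical.epsilon`; the right-hand side is a form that
can be differentiated. -/
theorem IsHurwitz.lyapunovSolution_eq {M : Matrix (Fin n) (Fin n) ℝ} (hM : IsHurwitz M)
    (W : Matrix (Fin n) (Fin n) ℝ) :
    lyapunovSolution M W = ContinuousLinearMap.inverse (lyapunovOperator M) (-W) := by
  obtain ⟨e, he⟩ := hM.exists_equiv
  have hspec : ∀ X : Matrix (Fin n) (Fin n) ℝ, Mᵀ * X + X * M + W = 0 ↔ e X = -W := fun X => by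
    have : e X = Mᵀ * X + X * M := by
      rw [← lyapunovOperator_apply, ← he]; rfl
    rw [this]
    exact eq_neg_iff_add_eq_zero.symm
  have hsol := Classical.epsilon_spec
    (p := fun X : Matrix (Fin n) (Fin n) ℝ => Mᵀ * X + X * M + W = 0)
    ⟨e.symm (-W), (hspec _).2 (e.apply_symm_apply _)⟩
  rw [← he, ContinuousLinearMap.inverse_equiv]
  exact (e.symm_apply_eq.2 ((hspec _).1 hsol).symm).symm

variable {F : Type*} [NormedAddCommGroup F] [NormedSpace ℝ F] {s : Set F}

theorem contDiffOn_matrix_mul {ι κ ν : Type*} [Fintype ι] [Fintype κ] [Fintype ν]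
    {f : F → Matrix ι κ ℝ} {g : F → Matrix κ ν ℝ} (hf : ContDiffOn ℝ 1 f s)
    (hg : ContDiffOn ℝ 1 g s) : ContDiffOn ℝ 1 (fun q => f q * g q) s := by
  refine contDiffOn_pi.2 fun i => contDiffOn_pi.2 fun j => ?_
  simp only [Matrix.mul_apply]
  exact ContDiffOn.sum fun k _ =>
    (contDiffOn_pi.1 (contDiffOn_pi.1 hf i) k).mul (contDiffOn_pi.1 (contDiffOn_pi.1 hg k) j)

theorem contDiffOn_matrix_transpose {ι κ : Type*} [Fintype ι] [Fintype κ]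
    {f : F → Matrix ι κ ℝ} (hf : ContDiffOn ℝ 1 f s) : ContDiffOn ℝ 1 (fun q => (f q)ᵀ) s :=
  contDiffOn_pi.2 fun j => contDiffOn_pi.2 fun i => contDiffOn_pi.1 (contDiffOn_pi.1 hf i) j

/-- Operator inversion is `C¹` near every invertible operator. Since this holds on a full
neighbourhood in operator space, `s` need not be open. -/
theorem contDiffOn_lyapunovSolution {M W : F → Matrix (Fin n) (Fin n) ℝ}
    (hM : ContDiffOn ℝ 1 M s) (hW : ContDiffOn ℝ 1 W s) (hs : ∀ q ∈ s, IsHurwitz (M q)) :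
    ContDiffOn ℝ 1 (fun q => lyapunovSolution (M q) (W q)) s := by
  refine ContDiffOn.congr (f := fun q =>
    ContinuousLinearMap.inverse (lyapunovOperator (M q)) (-W q)) ?_
    fun q hq => (hs q hq).lyapunovSolution_eq _
  refine ContDiffOn.clm_apply (fun q hq => ?_) hW.neg
  obtain ⟨e, he⟩ := (hs q hq).exists_equiv
  have hinv := contDiffAt_map_inverse (n := 1) e
  rw [he] at hinv
  exact hinv.comp_contDiffWithinAt q
    (contDiff_lyapunovOperator.contDiffAt.comp_contDiffWithinAt q (hM q hq))

theorem contDiffOn_policyGradient {m : ℕ} {A : F → Matrix (Fin n) (Fin n) ℝ}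
    (B : Matrix (Fin n) (Fin m) ℝ) (Q : Matrix (Fin n) (Fin n) ℝ)
    (R : Matrix (Fin m) (Fin m) ℝ) {K : F → Matrix (Fin m) (Fin n) ℝ}
    (hA : ContDiffOn ℝ 1 A s) (hK : ContDiffOn ℝ 1 K s)
    (hs : ∀ q ∈ s, IsHurwitz (A q - B * K q)) :
    ContDiffOn ℝ 1 (fun q => policyGradient (A q) B Q R (K q)) s := by
  have hAK : ContDiffOn ℝ 1 (fun q => A q - B * K q) s :=
    hA.sub (contDiffOn_matrix_mul contDiffOn_const hK)
  have hcost : ContDiffOn ℝ 1 (fun q => costMatrix (A q) B Q R (K q)) s :=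
    contDiffOn_lyapunovSolution hAK (contDiffOn_const.add (contDiffOn_matrix_mul
      (contDiffOn_matrix_mul (contDiffOn_matrix_transpose hK) contDiffOn_const) hK)) hs
  have hgram : ContDiffOn ℝ 1 (fun q => gramMatrix (A q) B (K q)) s :=
    contDiffOn_lyapunovSolution (contDiffOn_matrix_transpose hAK) contDiffOn_const
      fun q hq => (hs q hq).transpose
  exact (contDiffOn_const (c := (2 : ℝ))).smul (contDiffOn_matrix_mul
    ((contDiffOn_matrix_mul (contDiffOn_const (c := R)) hK).sub
      (contDiffOn_matrix_mul (contDiffOn_const (c := Bᵀ)) hcost)) hgram)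

/-- On a box of stabilizing gains, the policy gradient is `C¹` in the parameter and the gain. -/
theorem contDiffOn_vec_policyGradient {m p : ℕ} (A₀ : Matrix (Fin n) (Fin n) ℝ)
    (A₁ : Fin p → Matrix (Fin n) (Fin n) ℝ) (B : Matrix (Fin n) (Fin m) ℝ)
    (Q : Matrix (Fin n) (Fin n) ℝ) (R : Matrix (Fin m) (Fin m) ℝ)
    {P : Set (Fin p → ℝ)} {C : Set (Fin n × Fin m → ℝ)}
    (hC : C ⊆ Matrix.vec '' commonStableGains (affineFamily A₀ A₁) B P) :
    ContDiffOn ℝ 1 (fun q : (Fin p → ℝ) × (Fin n × Fin m → ℝ) =>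
      (policyGradient (affineFamily A₀ A₁ q.1) B Q R (Matrix.of fun i j => q.2 (j, i))).vec)
      (P ×ˢ C) := by
  have hA : ContDiff ℝ 1 fun q : (Fin p → ℝ) × (Fin n × Fin m → ℝ) =>
      affineFamily A₀ A₁ q.1 :=
    contDiff_const.add (ContDiff.sum fun i _ =>
      (by fun_prop : ContDiff ℝ 1
        fun q : (Fin p → ℝ) × (Fin n × Fin m → ℝ) => q.1 i).smul contDiff_const)
  have hK : ContDiff ℝ 1 fun q : (Fin p → ℝ) × (Fin n × Fin m → ℝ) =>
      (Matrix.of fun i j => q.2 (j, i) : Matrix (Fin m) (Fin n) ℝ) :=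
    contDiff_pi.2 fun i => contDiff_pi.2 fun j => (by fun_prop : ContDiff ℝ 1
      fun q : (Fin p → ℝ) × (Fin n × Fin m → ℝ) => q.2 (j, i))
  have hG := contDiffOn_policyGradient (s := P ×ˢ C) B Q R hA.contDiffOn hK.contDiffOn ?_
  · exact contDiffOn_pi.2 fun i => contDiffOn_pi.1 (contDiffOn_pi.1 hG i.2) i.1
  rintro ⟨ρ, x⟩ ⟨hρ, hx⟩
  obtain ⟨K, hKs, rfl⟩ := hC hx
  exact mem_iInter₂.1 hKs ρ hρ

end Lyapunov

/-! ### Geometry of the hyperrectangle and its projection matrix. -/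

section Box

variable {ι : Type*}

theorem jacobian_boxConstraint [Fintype ι] [DecidableEq ι] (l u x : ι → ℝ) :
    jacobian (boxConstraint l u) x = Matrix.fromRows 1 (-1) := by
  have hderiv : HasFDerivAt (boxConstraint l u)
      (ContinuousLinearMap.pi (Sum.elim (fun i => ContinuousLinearMap.proj (R := ℝ) i)
        (fun i => -ContinuousLinearMap.proj (R := ℝ) i))) x := by
    refine hasFDerivAt_pi.2 fun k => ?_
    rcases k with i | i
    · exact (hasFDerivAt_apply i x).sub_const (l i)
    · exact (hasFDerivAt_apply i x).const_sub (u i)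
  rw [jacobian, hderiv.fderiv]
  ext k j
  rcases k with i | i
  · simp [LinearMap.toMatrix'_apply, Matrix.one_apply, Pi.single_apply]
  · simp [LinearMap.toMatrix'_apply, Matrix.one_apply, Pi.single_apply]

/-- For a box, the projection matrix is diagonal, and each entry vanishes exactly on the two
facets bounding the corresponding coordinate. -/
theorem projectionMatrix_boxConstraint [Fintype ι] [DecidableEq ι] {l u x : ι → ℝ}
    (hx : ∀ i, 2 * (x i - l i) * (u i - x i) + (u i - l i) ≠ 0) :
    projectionMatrix (boxConstraint l u) x = Matrix.diagonal fun i =>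
      2 * (x i - l i) * (u i - x i) / (2 * (x i - l i) * (u i - x i) + (u i - l i)) := by
  set d : ι → ℝ := fun i => 2 * (x i - l i) * (u i - x i) + (u i - l i) with hd
  have hF : (2 : ℝ) • Matrix.diagonal (boxConstraint l u x) +
      Matrix.fromRows (1 : Matrix ι ι ℝ) (-1) * (Matrix.fromRows (1 : Matrix ι ι ℝ) (-1))ᵀ =
      Matrix.fromBlocks (Matrix.diagonal fun i => 2 * (x i - l i) + 1)
        (Matrix.diagonal fun _ => -1) (Matrix.diagonal fun _ => -1)
        (Matrix.diagonal fun i => 2 * (u i - x i) + 1) := by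
    ext (i | i) (j | j) <;> by_cases hij : i = j <;>
      simp [boxConstraint, Matrix.transpose_fromRows, hij]
  -- The matrix decouples into one 2×2 matrix per coordinate, with determinant `2 * d i`.
  have hinv : (Matrix.fromBlocks (Matrix.diagonal fun i => 2 * (x i - l i) + 1)
        (Matrix.diagonal fun _ => -1) (Matrix.diagonal fun _ => -1)
        (Matrix.diagonal fun i => 2 * (u i - x i) + 1))⁻¹ =
      Matrix.fromBlocks (Matrix.diagonal fun i => (2 * (u i - x i) + 1) / (2 * d i))
        (Matrix.diagonal fun i => 1 / (2 * d i)) (Matrix.diagonal fun i => 1 / (2 * d i))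
        (Matrix.diagonal fun i => (2 * (x i - l i) + 1) / (2 * d i)) := by
    refine Matrix.inv_eq_right_inv ?_
    rw [Matrix.fromBlocks_multiply, ← Matrix.fromBlocks_one]
    simp only [Matrix.diagonal_mul_diagonal, Matrix.diagonal_add]
    rw [← Matrix.diagonal_one, ← Matrix.diagonal_zero]
    congr 2 <;> funext i <;> have := hx i <;> simp only [hd] <;> field_simp <;> ring
  rw [projectionMatrix, jacobian_boxConstraint, hF, hinv, Matrix.transpose_fromRows,
    Matrix.fromCols_mul_fromBlocks, Matrix.fromCols_mul_fromRows]
  simp only [Matrix.transpose_one, Matrix.transpose_neg, Matrix.one_mul, Matrix.mul_one,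
    Matrix.neg_mul, Matrix.mul_neg, Matrix.diagonal_neg, Matrix.diagonal_add]
  rw [← Matrix.diagonal_one, Matrix.diagonal_sub]
  congr 1
  funext i
  have hdi : d i ≠ 0 := hx i
  change _ = _ / d i
  rw [eq_div_iff hdi]
  field_simp
  simp only [hd]
  ring

theorem interior_hyperrectangle [Fintype ι] (l u : ι → ℝ) :
    interior (hyperrectangle l u) = Set.pi univ fun i => Ioo (l i) (u i) := by
  rw [hyperrectangle, interior_pi_set finite_univ]
  simp

theorem convex_hyperrectangle (l u : ι → ℝ) : Convex ℝ (hyperrectangle l u) :=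
  convex_pi fun i _ => convex_Icc (l i) (u i)

theorem isCompact_hyperrectangle (l u : ι → ℝ) : IsCompact (hyperrectangle l u) :=
  isCompact_univ_pi fun _ => isCompact_Icc

theorem IsPolytope.convex {S : Set (ι → ℝ)} (hS : IsPolytope S) : Convex ℝ S := by
  obtain ⟨F, -, rfl⟩ := hS
  exact convex_convexHull ℝ F

theorem IsPolytope.isCompact {S : Set (ι → ℝ)} (hS : IsPolytope S) : IsCompact S := by
  obtain ⟨F, hF, rfl⟩ := hS
  exact hF.isCompact_convexHull ℝ

theorem isPolytope_hyperrectangle [Fintype ι] {l u : ι → ℝ} (hlu : ∀ i, l i ≤ u i) :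
    IsPolytope (hyperrectangle l u) := by
  refine ⟨Set.pi univ fun i => {l i, u i}, Finite.pi fun i => by simp, ?_⟩
  rw [convexHull_pi]
  simp [hyperrectangle, convexHull_pair, segment_eq_Icc (hlu _)]

/-- The nearest point of the box. -/
def clamp (l u x : ι → ℝ) : ι → ℝ := fun i => max (l i) (min (u i) (x i))

theorem clamp_mem {l u : ι → ℝ} (hlu : ∀ i, l i ≤ u i) (x : ι → ℝ) :
    clamp l u x ∈ hyperrectangle l u :=
  fun i _ => ⟨le_max_left _ _, max_le (hlu i) (min_le_left _ _)⟩

theorem clamp_of_mem {l u x : ι → ℝ} (hx : x ∈ hyperrectangle l u) : clamp l u x = x := by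
  funext i
  have := hx i (mem_univ i)
  rw [clamp, min_eq_right this.2, max_eq_right this.1]

theorem lipschitzWith_clamp [Fintype ι] (l u : ι → ℝ) : LipschitzWith 1 (clamp l u) :=
  LipschitzWith.of_dist_le_mul fun x y => by
    rw [NNReal.coe_one, one_mul]
    refine (dist_pi_le_iff dist_nonneg).2 fun i => ?_
    refine le_trans ?_ (dist_le_pi_dist x y i)
    simp only [clamp, Real.dist_eq]
    rw [max_comm (l i), max_comm (l i)]
    refine (abs_max_sub_max_le_abs _ _ _).trans ?_
    simpa using abs_min_sub_min_le_max (u i) (x i) (u i) (y i)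

theorem clamp_sub_le {l u x : ι → ℝ} (i : ι) : clamp l u x i - l i ≤ |x i - l i| := by
  rw [clamp, sub_le_iff_le_add]
  refine max_le (by linarith [abs_nonneg (x i - l i)]) ((min_le_right _ _).trans ?_)
  linarith [le_abs_self (x i - l i)]

theorem sub_clamp_le {l u x : ι → ℝ} (i : ι) :
    u i - clamp l u x i ≤ |u i - x i| := by
  have h1 : min (u i) (x i) ≤ clamp l u x i := le_max_right _ _
  rcases le_total (u i) (x i) with h | h
  · rw [min_eq_left h] at h1
    linarith [abs_nonneg (u i - x i)]
  · rw [min_eq_right h] at h1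
    linarith [le_abs_self (u i - x i)]

end Box

/-! ### Invariance of the interior under facet-vanishing fields. -/

section Invariance

open Filter Topology
open scoped NNReal

variable {Y : Type*} [PseudoMetricSpace Y] {ι : Type*}

/-- Freezing `ρ` at negative times turns one-sided continuity at `0` into two-sided continuity. -/
theorem continuousAt_comp_max_of_notMem_discontinuities {ρ : ℝ → Y} {t : ℝ}
    (ht : t ∉ discontinuities ρ) : ContinuousAt (fun τ => ρ (max τ 0)) t := by
  rcases lt_or_ge t 0 with h | h
  · have : (fun _ => ρ 0) =ᶠ[𝓝 t] fun τ => ρ (max τ 0) := by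
      filter_upwards [eventually_lt_nhds h] with τ hτ
      rw [max_eq_right hτ.le]
    exact continuousAt_const.congr this
  · have hc : ContinuousWithinAt ρ (Ici 0) (max t 0) := by
      rw [max_eq_left h]
      by_contra hc
      exact ht ⟨h, hc⟩
    exact hc.tendsto.comp (tendsto_nhdsWithin_iff.2
      ⟨(by fun_prop : Continuous fun τ : ℝ => max τ 0).continuousAt,
        Eventually.of_forall fun τ => le_max_right τ 0⟩)

variable {P : Set Y} {l u : ι → ℝ} {f : Y × (ι → ℝ) → ι → ℝ} {ρ : ℝ → Y} {y : ℝ → ι → ℝ}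

theorem continuousAt_field (hf : ContinuousOn f (P ×ˢ hyperrectangle l u))
    (hρ : ρ ∈ piecewiseContinuousTrajectories P) (hy : Continuous y)
    (hybox : ∀ t, y t ∈ hyperrectangle l u) {t : ℝ} (ht : t ∉ discontinuities ρ) :
    ContinuousAt (fun τ => f (ρ (max τ 0), y τ)) t := by
  have hmem : ∀ τ, (ρ (max τ 0), y τ) ∈ P ×ˢ hyperrectangle l u := fun τ =>
    ⟨hρ.1 _ (le_max_right _ _), hybox τ⟩
  exact (hf _ (hmem t)).tendsto.comp (tendsto_nhdsWithin_iff.2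
    ⟨(continuousAt_comp_max_of_notMem_discontinuities ht).prodMk hy.continuousAt,
      Eventually.of_forall hmem⟩)

/-- The finite set of discontinuities is null, so no one-sided limits or bounds on `ρ` near them are
needed. -/
theorem aestronglyMeasurable_field [Finite ι] (hf : ContinuousOn f (P ×ˢ hyperrectangle l u))
    (hρ : ρ ∈ piecewiseContinuousTrajectories P) (hy : Continuous y)
    (hybox : ∀ t, y t ∈ hyperrectangle l u) :
    AEStronglyMeasurable (fun τ => f (ρ (max τ 0), y τ)) volume := by
  have hD : volume.restrict (discontinuities ρ)ᶜ = volume :=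
    Measure.restrict_eq_self_of_ae_mem (compl_mem_ae_iff.2 (hρ.2.measure_zero volume))
  rw [← hD]
  exact ContinuousOn.aestronglyMeasurable
    (fun t ht => (continuousAt_field hf hρ hy hybox ht).continuousWithinAt)
    hρ.2.measurableSet.compl

/-- A field on a box whose components vanish linearly at the corresponding facets leaves the
interior of the box invariant, and its integral solutions are global. -/
theorem exists_solution_in_interior [Fintype ι] {L : ℝ≥0} {c : ℝ} {x₀ : ι → ℝ}
    (hlip : LipschitzOnWith L f (P ×ˢ hyperrectangle l u))
    (hbdd : ∀ q ∈ P ×ˢ hyperrectangle l u, ∀ i, |f q i| ≤ c)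
    (hl : ∀ q ∈ P ×ˢ hyperrectangle l u, ∀ i, |f q i| ≤ c * (q.2 i - l i))
    (hu : ∀ q ∈ P ×ˢ hyperrectangle l u, ∀ i, |f q i| ≤ c * (u i - q.2 i))
    (hc : 0 ≤ c) (hρ : ρ ∈ piecewiseContinuousTrajectories P)
    (hx₀ : x₀ ∈ interior (hyperrectangle l u)) :
    ∃ x : ℝ → ι → ℝ, x 0 = x₀ ∧ Continuous x ∧
      (∀ t, 0 ≤ t → x t ∈ interior (hyperrectangle l u)) ∧
      (∀ t, 0 ≤ t → IntervalIntegrable (fun τ => f (ρ τ, x τ)) volume 0 t) ∧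
      (∀ t, 0 ≤ t → x t = x₀ + ∫ τ in (0 : ℝ)..t, f (ρ τ, x τ)) ∧
      ∀ t, 0 ≤ t → t ∉ discontinuities ρ →
        HasDerivWithinAt x (f (ρ t, x t)) (Ici 0) t := by
  rw [interior_hyperrectangle] at hx₀ ⊢
  have hlu : ∀ i, l i ≤ u i := fun i =>
    ((hx₀ i (mem_univ i)).1.trans (hx₀ i (mem_univ i)).2).le
  have hmem : ∀ τ x, (ρ (max τ 0), clamp l u x) ∈ P ×ˢ hyperrectangle l u := fun τ x =>
    ⟨hρ.1 _ (le_max_right _ _), clamp_mem hlu x⟩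
  have hnorm : ∀ q ∈ P ×ˢ hyperrectangle l u, ‖f q‖ ≤ c := fun q hq =>
    (pi_norm_le_iff_of_nonneg hc).2 (hbdd q hq)
  have hmeas : ∀ y : ℝ → ι → ℝ, Continuous y →
      AEStronglyMeasurable (fun τ => f (ρ (max τ 0), clamp l u (y τ))) volume := fun y hy =>
    aestronglyMeasurable_field hlip.continuousOn hρ ((lipschitzWith_clamp l u).continuous.comp hy)
      fun t => clamp_mem hlu _
  -- Composing with `clamp` and `max τ 0` makes the field globally defined, bounded and Lipschitz
  -- with the same constants.
  obtain ⟨x, hxc, hx⟩ := exists_integral_solution (L := L) (c := c)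
    (h := fun τ x => f (ρ (max τ 0), clamp l u x))
    (fun τ => LipschitzWith.of_dist_le_mul fun x y => by
      refine (hlip.dist_le_mul _ (hmem τ x) _ (hmem τ y)).trans ?_
      rw [Prod.dist_eq, dist_self, max_eq_right dist_nonneg]
      have := (lipschitzWith_clamp l u).dist_le_mul x y
      rw [NNReal.coe_one, one_mul] at this
      gcongr) (fun τ x => hnorm _ (hmem τ x)) hmeas x₀
  have hx0 : x 0 = x₀ := by simpa using hx 0 le_rfl
  have hii : ∀ a b, IntervalIntegrable
      (fun τ => f (ρ (max τ 0), clamp l u (x τ))) volume a b :=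
    intervalIntegrable_of_norm_le (hmeas x hxc) fun τ => hnorm _ (hmem τ _)
  have hcomp : ∀ i t, 0 ≤ t →
      x t i = x 0 i + ∫ τ in (0 : ℝ)..t, f (ρ (max τ 0), clamp l u (x τ)) i := by
    intro i t ht
    have := (ContinuousLinearMap.proj (R := ℝ) (φ := fun _ : ι => ℝ) i).intervalIntegral_comp_comm
      (hii 0 t)
    simp only [ContinuousLinearMap.proj_apply] at this
    rw [this, hx0, ← Pi.add_apply, ← hx t ht]
  have hiic : ∀ i a b, IntervalIntegrable
      (fun τ => f (ρ (max τ 0), clamp l u (x τ)) i) volume a b := fun i a b =>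
    intervalIntegrable_of_norm_le
      ((continuous_apply i).comp_aestronglyMeasurable (hmeas x hxc))
      (fun τ => hbdd _ (hmem τ _) i) a b
  -- Before `x` is known to stay in the box, the facet bounds hold at `clamp l u x`; its distances
  -- to the facets are at most the absolute values `|x i - l i|` and `|u i - x i|`, which is what
  -- the sign argument needs.
  have hint : ∀ t, 0 ≤ t → x t ∈ Set.pi univ fun i => Ioo (l i) (u i) := by
    intro t ht i hi
    have h0 := hx₀ i hi
    rw [← hx0] at h0
    constructor
    · refine sub_pos.1 (pos_of_abs_le_mul_abs (φ := fun t => x t i - l i) (C := c) ht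
        (by fun_prop) (hiic i 0 t) (fun s hs => ?_) (fun s _ => ?_) (sub_pos.2 h0.1))
      · rw [hcomp i s hs.1]
        ring
      · exact (hl _ (hmem s _) i).trans (mul_le_mul_of_nonneg_left (clamp_sub_le i) hc)
    · refine sub_pos.1 (pos_of_abs_le_mul_abs (φ := fun t => u i - x t i) (C := c) ht
        (by fun_prop) (hiic i 0 t).neg (fun s hs => ?_) (fun s _ => ?_) (sub_pos.2 h0.2))
      · simp only [Pi.neg_apply]
        rw [intervalIntegral.integral_neg, hcomp i s hs.1]
        ring
      · rw [Pi.neg_apply, abs_neg]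
        exact (hu _ (hmem s _) i).trans (mul_le_mul_of_nonneg_left (sub_clamp_le i) hc)
  have hclamp : ∀ t, 0 ≤ t → f (ρ (max t 0), clamp l u (x t)) = f (ρ t, x t) := fun t ht => by
    rw [max_eq_left ht, clamp_of_mem fun i hi => Ioo_subset_Icc_self (hint t ht i hi)]
  have hcongr : ∀ t, 0 ≤ t → EqOn (fun τ => f (ρ (max τ 0), clamp l u (x τ)))
      (fun τ => f (ρ τ, x τ)) (uIcc 0 t) := fun t ht τ hτ => by
    rw [uIcc_of_le ht] at hτ
    exact hclamp τ hτ.1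
  refine ⟨x, hx0, hxc, hint,
    fun t ht => (hii 0 t).congr_uIoo ((hcongr t ht).mono uIoo_subset_uIcc_self),
    fun t ht => ?_, fun t ht htD => ?_⟩
  · rw [hx t ht, intervalIntegral.integral_congr (hcongr t ht)]
  · have hd : HasDerivAt (fun s => ∫ τ in (0 : ℝ)..s, f (ρ (max τ 0), clamp l u (x τ)))
        (f (ρ (max t 0), clamp l u (x t))) t :=
      intervalIntegral.integral_hasDerivAt_right (hii 0 t)
        (hmeas x hxc).stronglyMeasurableAtFilter
        (continuousAt_field hlip.continuousOn hρ ((lipschitzWith_clamp l u).continuous.comp hxc)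
          (fun t => clamp_mem hlu _) htD)
    rw [hclamp t ht] at hd
    exact (hd.const_add x₀).hasDerivWithinAt.congr (fun s hs => hx s hs) (hx t ht)

end Invariance

/-! ### The controller field: uniform bounds and integral form. -/

section Controller

open scoped NNReal

variable {n m p : ℕ} (A₀ : Matrix (Fin n) (Fin n) ℝ) (A₁ : Fin p → Matrix (Fin n) (Fin n) ℝ)
  (B : Matrix (Fin n) (Fin m) ℝ) (Q : Matrix (Fin n) (Fin n) ℝ) (R : Matrix (Fin m) (Fin m) ℝ)
  (l u : Fin n × Fin m → ℝ) (α : ℝ)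

/-- The right-hand side of the controller equation in vectorized coordinates, as a function of the
parameter and the gain. -/
noncomputable def controllerField (q : (Fin p → ℝ) × (Fin n × Fin m → ℝ)) : Fin n × Fin m → ℝ :=
  -α • projectedGradient (affineFamily A₀ A₁ q.1) B Q R l u (Matrix.of fun i j => q.2 (j, i))

variable {l u}

theorem controllerField_apply (hlu : ∀ i, l i < u i)
    {q : (Fin p → ℝ) × (Fin n × Fin m → ℝ)} (hq : q.2 ∈ hyperrectangle l u)
    (i : Fin n × Fin m) :
    controllerField A₀ A₁ B Q R l u α q i =
      -α * (2 * (q.2 i - l i) * (u i - q.2 i) /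
          (2 * (q.2 i - l i) * (u i - q.2 i) + (u i - l i)) *
        (policyGradient (affineFamily A₀ A₁ q.1) B Q R
          (Matrix.of fun i j => q.2 (j, i))).vec i) := by
  have hx : ∀ i, 2 * (q.2 i - l i) * (u i - q.2 i) + (u i - l i) ≠ 0 := fun i => by
    have h := hq i (mem_univ i)
    have h1 := sub_nonneg.2 h.1
    have h2 := sub_nonneg.2 h.2
    have h3 := sub_pos.2 (hlu i)
    positivity
  have hvec : (Matrix.of fun i j => q.2 (j, i) : Matrix (Fin m) (Fin n) ℝ).vec = q.2 := rfl
  rw [controllerField, projectedGradient, hvec, projectionMatrix_boxConstraint hx, Pi.smul_apply,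
    Matrix.mulVec_diagonal, smul_eq_mul]

theorem exists_controllerField_bounds {P : Set (Fin p → ℝ)} (hP : IsPolytope P)
    (hC : hyperrectangle l u ⊆ Matrix.vec '' commonStableGains (affineFamily A₀ A₁) B P)
    (hlu : ∀ i, l i < u i) :
    ∃ (L : ℝ≥0) (c : ℝ), 0 ≤ c ∧
      LipschitzOnWith L (controllerField A₀ A₁ B Q R l u α) (P ×ˢ hyperrectangle l u) ∧
      ∀ q ∈ P ×ˢ hyperrectangle l u, ∀ i,
        |controllerField A₀ A₁ B Q R l u α q i| ≤ c ∧
        |controllerField A₀ A₁ B Q R l u α q i| ≤ c * (q.2 i - l i) ∧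
        |controllerField A₀ A₁ B Q R l u α q i| ≤ c * (u i - q.2 i) := by
  have hcomp : IsCompact (P ×ˢ hyperrectangle l u) :=
    hP.isCompact.prod (isCompact_hyperrectangle l u)
  have hG := contDiffOn_vec_policyGradient A₀ A₁ B Q R hC
  set G := fun q : (Fin p → ℝ) × (Fin n × Fin m → ℝ) =>
    (policyGradient (affineFamily A₀ A₁ q.1) B Q R (Matrix.of fun i j => q.2 (j, i))).vec
  have hsmooth : ContDiffOn ℝ 1 (controllerField A₀ A₁ B Q R l u α)
      (P ×ˢ hyperrectangle l u) := by
    refine contDiffOn_pi.2 fun i => ContDiffOn.congr ?_ fun q hq =>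
      controllerField_apply A₀ A₁ B Q R α hlu hq.2 i
    refine contDiffOn_const.mul (ContDiffOn.mul (ContDiffOn.div ?_ ?_ ?_)
      (contDiffOn_pi.1 hG i))
    · exact ContDiff.contDiffOn (by fun_prop)
    · exact ContDiff.contDiffOn (by fun_prop)
    · intro q hq
      have h := hq.2 i (mem_univ i)
      have h1 := sub_nonneg.2 h.1
      have h2 := sub_nonneg.2 h.2
      have h3 := sub_pos.2 (hlu i)
      positivity
  obtain ⟨L, hL⟩ := hsmooth.exists_lipschitzOnWith one_ne_zero
    (hP.convex.prod (convex_hyperrectangle l u)) hcomp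
  obtain ⟨b, hb⟩ := hcomp.exists_bound_of_continuousOn hG.continuousOn
  -- The factor `2` comes from bounding the diagonal weight by `2 * d` with `d` equal to `1` or
  -- either facet distance. The absolute value of `b` is taken because its sign is unknown when `P`
  -- is empty.
  refine ⟨L, 2 * (|α| * |b|), by positivity, hL, fun q hq i => ?_⟩
  have h := hq.2 i (mem_univ i)
  have ha := sub_nonneg.2 h.1
  have hb' := sub_nonneg.2 h.2
  have hw := sub_pos.2 (hlu i)
  have hGi : |G q i| ≤ |b| := (norm_le_pi_norm (G q) i).trans ((hb q hq).trans (le_abs_self b))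
  rw [controllerField_apply A₀ A₁ B Q R α hlu hq.2 i, abs_mul, abs_mul, abs_neg,
    abs_of_nonneg (by positivity : (0 : ℝ) ≤ 2 * (q.2 i - l i) * (u i - q.2 i) /
      (2 * (q.2 i - l i) * (u i - q.2 i) + (u i - l i)))]
  have key : ∀ d : ℝ, 2 * (q.2 i - l i) * (u i - q.2 i) /
      (2 * (q.2 i - l i) * (u i - q.2 i) + (u i - l i)) ≤ 2 * d →
      |α| * (2 * (q.2 i - l i) * (u i - q.2 i) /
        (2 * (q.2 i - l i) * (u i - q.2 i) + (u i - l i)) * |G q i|) ≤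
        2 * (|α| * |b|) * d := by
    intro d hd
    calc _ ≤ |α| * (2 * d * |b|) := by
          refine mul_le_mul_of_nonneg_left ?_ (abs_nonneg α)
          exact mul_le_mul hd hGi (abs_nonneg _) (le_trans (by positivity) hd)
      _ = _ := by ring
  have hw' : u i - l i = (q.2 i - l i) + (u i - q.2 i) := by ring
  rw [hw'] at hw key ⊢
  generalize q.2 i - l i = a at ha hw key ⊢
  generalize u i - q.2 i = b' at hb' hw key ⊢
  have hab : 0 ≤ a * b' := mul_nonneg ha hb'
  have hden : 0 < 2 * a * b' + (a + b') := by nlinarith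
  refine ⟨(key 1 ?_).trans_eq (mul_one _), key a ?_, key b' ?_⟩ <;> rw [div_le_iff₀ hden]
  · nlinarith
  · nlinarith [mul_nonneg ha hab, mul_nonneg ha ha]
  · nlinarith [mul_nonneg hb' hab, mul_nonneg hb' hb']

variable {A₀ A₁ B Q R α}

theorem IsControllerTrajectory.intervalIntegrable {ρ : ℝ → Fin p → ℝ} {J : Set ℝ}
    {K : ℝ → Matrix (Fin m) (Fin n) ℝ}
    (hK : IsControllerTrajectory (affineFamily A₀ A₁) B Q R l u α ρ J K) {t : ℝ} (ht : t ∈ J) :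
    IntervalIntegrable (fun τ => controllerField A₀ A₁ B Q R l u α (ρ τ, (K τ).vec))
      volume 0 t :=
  (hK.integrable t ht).smul (-α)

theorem IsControllerTrajectory.vec_eq {ρ : ℝ → Fin p → ℝ} {J : Set ℝ}
    {K : ℝ → Matrix (Fin m) (Fin n) ℝ}
    (hK : IsControllerTrajectory (affineFamily A₀ A₁) B Q R l u α ρ J K) {t : ℝ} (ht : t ∈ J) :
    (K t).vec = (K 0).vec +
      ∫ τ in (0 : ℝ)..t, controllerField A₀ A₁ B Q R l u α (ρ τ, (K τ).vec) := by
  rw [hK.equation t ht, sub_eq_add_neg, ← neg_smul, ← intervalIntegral.integral_smul]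
  rfl

theorem IsControllerTrajectory.of_integral {ρ : ℝ → Fin p → ℝ} {J : Set ℝ}
    {x : ℝ → Fin n × Fin m → ℝ} (hα : α ≠ 0) (h0 : x 0 ∈ interior (hyperrectangle l u))
    (hint : ∀ t ∈ J, IntervalIntegrable
      (fun τ => controllerField A₀ A₁ B Q R l u α (ρ τ, x τ)) volume 0 t)
    (heq : ∀ t ∈ J, x t = x 0 +
      ∫ τ in (0 : ℝ)..t, controllerField A₀ A₁ B Q R l u α (ρ τ, x τ)) :
    IsControllerTrajectory (affineFamily A₀ A₁) B Q R l u α ρ J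
      (fun t => Matrix.of fun i j => x t (j, i)) where
  initial := h0
  integrable t ht := by
    have := (hint t ht).smul (-α)⁻¹
    simpa only [controllerField, Pi.smul_def, inv_smul_smul₀ (neg_ne_zero.2 hα)] using this
  equation t ht := by
    rw [sub_eq_add_neg, ← neg_smul, ← intervalIntegral.integral_smul]
    exact heq t ht

end Controller

end ProjectedLQR

/-! ### The main theorem. -/

theorem mainTheorem5 {n m p : ℕ}
    (A₀ : Matrix (Fin n) (Fin n) ℝ) (A₁ : Fin p → Matrix (Fin n) (Fin n) ℝ)
    (B : Matrix (Fin n) (Fin m) ℝ)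
    (Q : Matrix (Fin n) (Fin n) ℝ) (hQ : Q.PosSemidef)
    (R : Matrix (Fin m) (Fin m) ℝ) (hR : R.PosDef)
    (P : Set (Fin p → ℝ)) (hP : ProjectedLQR.IsPolytope P)
    (l u : Fin n × Fin m → ℝ) (α : ℝ) (hα : 0 < α)
    (hC : ProjectedLQR.hyperrectangle l u ⊆
      Matrix.vec '' ProjectedLQR.commonStableGains (ProjectedLQR.affineFamily A₀ A₁) B P) :
    ∃ V : Set (Fin n × Fin m → ℝ), ProjectedLQR.IsPolytope V ∧ 0 ∈ V ∧
      ∀ ρ ∈ ProjectedLQR.piecewiseContinuousTrajectories P,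
        -- from every admissible initial gain there is exactly one trajectory, defined for all time
        (∀ K₀ : Matrix (Fin m) (Fin n) ℝ,
          K₀.vec ∈ interior (ProjectedLQR.hyperrectangle l u) →
          ∃ K : ℝ → Matrix (Fin m) (Fin n) ℝ, K 0 = K₀ ∧
            ProjectedLQR.IsControllerTrajectory (ProjectedLQR.affineFamily A₀ A₁) B Q R l u α ρ
              (Set.Ici 0) K ∧
            ∀ (J : Set ℝ) (K' : ℝ → Matrix (Fin m) (Fin n) ℝ),
              J ⊆ Set.Ici 0 → 0 ∈ J → J.OrdConnected → K' 0 = K₀ →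
              ProjectedLQR.IsControllerTrajectory (ProjectedLQR.affineFamily A₀ A₁) B Q R l u α ρ
                J K' → Set.EqOn K' K J) ∧
        -- every trajectory stays in the interior of the hyperrectangle and is continuous, with
        -- derivative in `V` wherever `ρ` is continuous
        ∀ K : ℝ → Matrix (Fin m) (Fin n) ℝ,
          ProjectedLQR.IsControllerTrajectory (ProjectedLQR.affineFamily A₀ A₁) B Q R l u α ρ
            (Set.Ici 0) K →
          (∀ t : ℝ, 0 ≤ t → (K t).vec ∈ interior (ProjectedLQR.hyperrectangle l u)) ∧
          (fun t => (K t).vec) ∈ ProjectedLQR.rateBoundedTrajectories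
            (ProjectedLQR.hyperrectangle l u) V (ProjectedLQR.discontinuities ρ) := by
  open ProjectedLQR in
  -- For a degenerate box the interior is empty, so there are no admissible gains and `V = {0}`
  -- serves.
  by_cases hlu : ∀ i, l i < u i
  swap
  · have hempty : interior (hyperrectangle l u) = ∅ := by
      push Not at hlu
      obtain ⟨i, hi⟩ := hlu
      rw [interior_hyperrectangle]
      exact univ_pi_eq_empty (i := i) (Ioo_eq_empty hi.not_gt)
    refine ⟨hyperrectangle 0 0, isPolytope_hyperrectangle fun _ => le_rfl, by
      simp [hyperrectangle], fun ρ _ => ⟨fun K₀ hK₀ => ?_, fun K hK => ?_⟩⟩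
    · simp [hempty] at hK₀
    · simpa [hempty] using hK.initial
  obtain ⟨L, c, hc, hlip, hbd⟩ := exists_controllerField_bounds A₀ A₁ B Q R α hP hC hlu
  -- The cube of radius `c` contains all values of the field on `P ×ˢ hyperrectangle l u`, hence
  -- works for all `ρ` at once.
  refine ⟨hyperrectangle (fun _ => -c) fun _ => c,
    isPolytope_hyperrectangle fun _ => by linarith, fun _ _ => ⟨by simpa using hc, hc⟩, ?_⟩
  intro ρ hρ
  have hsol := fun x₀ (hx₀ : x₀ ∈ interior (hyperrectangle l u)) =>
    exists_solution_in_interior hlip (fun q hq i => (hbd q hq i).1)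
      (fun q hq i => (hbd q hq i).2.1) (fun q hq i => (hbd q hq i).2.2) hc hρ hx₀
  -- Only `x` is assumed to stay in the interior. The same comparison yields uniqueness on any
  -- interval `J` and, for `J = Ici 0`, transfers invariance and differentiability to an arbitrary
  -- trajectory.
  have huniq : ∀ (x : ℝ → Fin n × Fin m → ℝ) (J : Set ℝ) (K : ℝ → Matrix (Fin m) (Fin n) ℝ),
      (∀ t, 0 ≤ t → x t ∈ interior (hyperrectangle l u)) →
      (∀ t, 0 ≤ t → IntervalIntegrable
        (fun τ => controllerField A₀ A₁ B Q R l u α (ρ τ, x τ)) volume 0 t) →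
      (∀ t, 0 ≤ t → x t = x 0 +
        ∫ τ in (0 : ℝ)..t, controllerField A₀ A₁ B Q R l u α (ρ τ, x τ)) →
      J ⊆ Ici 0 → 0 ∈ J → J.OrdConnected → (K 0).vec = x 0 →
      IsControllerTrajectory (affineFamily A₀ A₁) B Q R l u α ρ J K →
      ∀ t ∈ J, (K t).vec = x t := by
    intro x J K hxint hxi hxe hJ h0J hJc h0 hK t ht
    have hIcc : Icc 0 t ⊆ J := hJc.out h0J ht
    refine eqOn_of_integral_solution (U := hyperrectangle l u) (L := L)
      (h := fun τ x => controllerField A₀ A₁ B Q R l u α (ρ τ, x)) (y := fun τ => (K τ).vec)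
      (fun τ hτ => ?_) (fun s hs => hxint s hs.1) (hxi t (hJ ht)) (hK.intervalIntegrable ht)
      (fun s hs => hxe s hs.1) (fun s hs => hK.vec_eq (hIcc hs)) h0 ⟨hJ ht, le_rfl⟩
    refine LipschitzOnWith.of_dist_le_mul fun a ha b hb => ?_
    refine (hlip.dist_le_mul _ ⟨hρ.1 τ hτ.1, ha⟩ _ ⟨hρ.1 τ hτ.1, hb⟩).trans_eq ?_
    rw [Prod.dist_eq, dist_self, max_eq_right dist_nonneg]
  refine ⟨fun K₀ hK₀ => ?_, fun K hK => ?_⟩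
  · obtain ⟨x, hx0, -, hxint, hxi, hxe, -⟩ := hsol _ hK₀
    rw [← hx0] at hxe
    refine ⟨fun t => Matrix.of fun i j => x t (j, i), ?_, ?_, ?_⟩
    · simp only [hx0]
      rfl
    · exact IsControllerTrajectory.of_integral hα.ne' (hx0 ▸ hK₀) hxi hxe
    · intro J K' hJ h0J hJc h0 hK' t ht
      refine Matrix.vec_inj.1 ?_
      exact huniq x J K' hxint hxi hxe hJ h0J hJc (by rw [h0, hx0]) hK' t ht
  · obtain ⟨x, hx0, hxc, hxint, hxi, hxe, hxd⟩ := hsol _ hK.initial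
    rw [← hx0] at hxe
    have hKx : ∀ t, 0 ≤ t → (K t).vec = x t := fun t ht =>
      huniq x (Ici 0) K hxint hxi hxe Subset.rfl (mem_Ici.2 le_rfl) ordConnected_Ici
        hx0.symm hK t ht
    have hKint : ∀ t, 0 ≤ t → (K t).vec ∈ interior (hyperrectangle l u) := fun t ht => by
      rw [hKx t ht]
      exact hxint t ht
    refine ⟨hKint, fun t ht => interior_subset (hKint t ht),
      hxc.continuousOn.congr fun t ht => hKx t ht, fun t ht htD =>
      ⟨_, fun i _ => ?_, (hxd t ht htD).congr (fun s hs => hKx s hs) (hKx t ht)⟩⟩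
    exact abs_le.1 (hbd (ρ t, x t) ⟨hρ.1 t ht, interior_subset (hxint t ht)⟩ i).1
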